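/- **Conventions.** A simplicial complex is a family of finite sets closed under taking subsets; $\langle G_1,\dots,G_q\rangle$ is the complex generated by $G_1,\dots,G_q$, and $\langle\ \rangle$ is the void complex, without any face. A facet is a maximal face, and a subcollection of $\Delta$ is a complex whose facets are facets of $\Delta$. Write $F_W^c=W\setminus F$. Let $K$ be a field and let $\widetilde H_i(\cdot)$, $i\in\mathbb Z$, be reduced simplicial homology with coefficients in $K$ (the empty face, if present, is in degree $-1$). Let $l,m,n$ be positive integers with $2\le m\le n$, $l\mid n$ and $l\le\min\{m-1,\frac n2\}$. Write $m=tl+s$ with $0\le s<l$ and suppose $t\ge 2$. Let $\Delta_{m,l}(C_n)$ be the path complex of the $n$-cycle on $\{x_1,\dots,x_n\}$, generated by the sets $\{x_{(a-1)l+1},\dots,x_{(a-1)l+m}\}$, $1\le a\le n/l$, indices being read modulo $n$. A run of length $q\ge 1$ is a complex with $(q-1)l+m$ vertices that can be labelled $y_1,y_2,\dots,y_{(q-1)l+m}$ so that it is generated by its $q$ facets $\{y_{(a-1)l+1},\dots,y_{(a-1)l+m}\}$, $1\le a\le q$; such a labelling is called standard, and it orders the facets. Let $\Gamma$ be a subcollection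 of $\Delta_{m,l}(C_n)$ whose connected components are runs $R_1,\dots,R_r$ of lengths $s_1,\dots,s_r$, with chosen standard labellings. Let $V=V(\Gamma)$ be its vertex set and let $$\mathcal E=E(s_1,\dots,s_r)=\langle F_V^c : F \text{ a facet of }\Gamma\rangle .$$ Write $s_j=p_j(t+1)+d_j$ with $p_j\ge 0$ and $0\le d_j\le t$. **Proposition 4.3.** For every $1\le j\le r$ and every integer $i$ the following hold. Let $\mathcal F_j$ be the set of facets of the runs $R_h$, $h\ne j$, and let $F_{j,1},\dots,F_{j,s_j}$ be the facets of $R_j$ in the order of its standard labelling. 1. If $s_j\ge t+2$, then $$\widetilde H_i(\mathcal E)\cong\widetilde H_{i-2p_j}\big(\big\langle F_W^c : F\in\mathcal F_j\cup\{F_{j,p_j(t+1)+1},\dots,F_{j,p_j(t+1)+d_j}\}\big\rangle\big),$$ where $W=V\setminus A$ and $A$ is the union of the first $(p_j-1)(t+1)+2$ facets of $R_j$. 2. If $s_j=2$ and $r\ge 2$, then $\widetilde H_i(\mathcal E)\cong\widetilde H_{i-2}(\langle F_W^c : F\in\mathcal F_j\rangle)$, where $W$ is the vertex set of $\langle \mathcal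 F_j\rangle$. 3. If $s_j=1$ and $r\ge 2$, then $\widetilde H_i(\mathcal E)\cong\widetilde H_{i-1}(\langle F_W^c : F\in\mathcal F_j\rangle)$, where $W$ is the vertex set of $\langle \mathcal F_j\rangle$. 4. If $d_j\notin\{1,2\}$, then $\widetilde H_i(\mathcal E)=0$. -/

import Mathlib

/-! # Simplicial complexes

A simplicial complex with vertices in `V` is a family of finite subsets of `V` closed under passing
to subsets, that is, a `LowerSet (Finset V)`.  The void complex `∅ = ⟨⟩` (no face at all) and the
complex `{∅}` are different complexes. -/

namespace PathRuns

/-- The simplicial complex `⟨F₁, …, F_q⟩` generated by a collection of finite sets. -/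
def generated {V : Type*} (𝓕 : Set (Finset V)) : LowerSet (Finset V) :=
  lowerClosure 𝓕

/-- The set of facets of a simplicial complex: the faces that are maximal under inclusion. -/
def facets {V : Type*} (Δ : LowerSet (Finset V)) : Set (Finset V) :=
  {F | Maximal (fun G => G ∈ Δ) F}

open Classical in
/-- The vertex set `V(Δ)`. -/
noncomputable def vertexSet {V : Type*} [Fintype V] (Δ : LowerSet (Finset V)) : Finset V :=
  Finset.univ.filter (fun v => {v} ∈ Δ)

/-- A subcollection of `Δ` is a simplicial complex whose facets are also facets of `Δ`. -/
def IsSubcollection {V : Type*} (Γ Δ : LowerSet (Finset V)) : Prop :=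
  facets Γ ⊆ facets Δ

/-- The complex `⟨(F₁)_W^c, …, (F_q)_W^c⟩` generated by the complements `F_W^c = W \ F` of the
members `F` of a collection. -/
def complementComplex {V : Type*} [DecidableEq V] (W : Finset V) (𝓕 : Set (Finset V)) :
    LowerSet (Finset V) :=
  generated ((fun F => W \ F) '' 𝓕)

/-- The complex `Γ_Y^c`, `Y = V(Γ)`, generated by the complements in `V(Γ)` of the facets of `Γ`.
If `Γ` is a disjoint union of runs of lengths `s₁, …, s_r`, this is `E(s₁, …, s_r)`. -/
noncomputable def facetComplement {V : Type*} [Fintype V] [DecidableEq V]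
    (Γ : LowerSet (Finset V)) : LowerSet (Finset V) :=
  complementComplex (vertexSet Γ) (facets Γ)

/-! # Reduced simplicial homology

Faces are oriented by a fixed linear order on the finite vertex set `V`.  A chain
`∑ c_F F` is written as its coefficient function `c : Finset V → K`.  The empty face spans
degree `-1`. -/

/-- The number of elements of `F` that are smaller than `v`.  For `v ∈ F` this is the position of
`v` in `F`, counted from `0` in increasing order. -/
def position {V : Type*} [LinearOrder V] (F : Finset V) (v : V) : ℕ :=
  (F.filter (fun w => w < v)).card

/-- The simplicial boundary `∂[v₀, …, v_q] = ∑ₐ (-1)ᵃ [v₀, …, v̂ₐ, …, v_q]` for `v₀ < ⋯ < v_q`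
(so `∂[v] = ∅` and `∂∅ = 0`), extended linearly.  In coefficients: `G` occurs in the boundary of the
faces `G ∪ {v}`, `v ∉ G`, with the sign given by the position of `v`.  The lemma `boundary_single`
below is the formula on faces. -/
def boundary (K : Type*) [Field K] (V : Type*) [Fintype V] [LinearOrder V] :
    (Finset V → K) →ₗ[K] (Finset V → K) where
  toFun c G := ∑ v ∈ Gᶜ, (-1 : K) ^ position G v * c (insert v G)
  map_add' c c' := by
    funext G
    simp [mul_add, Finset.sum_add_distrib]
  map_smul' a c := by
    funext G
    simp only [Pi.smul_apply, smul_eq_mul, RingHom.id_apply, Finset.mul_sum]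
    exact Finset.sum_congr rfl (fun v _ => by ring)

/-- The chains `C_i(Δ)` of degree `i`: linear combinations of the faces with `i + 1` vertices. -/
def chains (K : Type*) [Field K] {V : Type*} (Δ : LowerSet (Finset V)) (i : ℤ) :
    Submodule K (Finset V → K) where
  carrier := {c | ∀ F, c F ≠ 0 → F ∈ Δ ∧ (F.card : ℤ) = i + 1}
  zero_mem' F h := absurd rfl h
  add_mem' {c c'} hc hc' F h := by
    by_cases h0 : c F = 0
    · exact hc' F (fun h1 => h (by simp [h0, h1]))
    · exact hc F h0
  smul_mem' a c hc F h := hc F (fun h0 => h (by simp [h0]))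

/-- The cycles `Z_i(Δ)`. -/
def cycles (K : Type*) [Field K] {V : Type*} [Fintype V] [LinearOrder V]
    (Δ : LowerSet (Finset V)) (i : ℤ) : Submodule K (Finset V → K) :=
  chains K Δ i ⊓ LinearMap.ker (boundary K V)

/-- The boundaries `B_i(Δ) = ∂ C_{i+1}(Δ)`. -/
def boundaries (K : Type*) [Field K] {V : Type*} [Fintype V] [LinearOrder V]
    (Δ : LowerSet (Finset V)) (i : ℤ) : Submodule K (Finset V → K) :=
  (chains K Δ (i + 1)).map (boundary K V)

/-- The reduced homology `H̃_i(Δ) = Z_i(Δ) / B_i(Δ)` with coefficients in the field `K`.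
The lemma `boundaries_le_cycles` below records that `B_i(Δ) ⊆ Z_i(Δ)`. -/
abbrev ReducedHomology (K : Type*) [Field K] {V : Type*} [Fintype V] [LinearOrder V]
    (Δ : LowerSet (Finset V)) (i : ℤ) : Type _ :=
  cycles K Δ i ⧸ (boundaries K Δ i).submoduleOf (cycles K Δ i)

theorem boundary_single (K : Type*) [Field K] {V : Type*} [Fintype V] [LinearOrder V]
    (F : Finset V) :
    boundary K V (Pi.single F 1) =
      ∑ v ∈ F, (-1 : K) ^ position F v • Pi.single (F.erase v) (1 : K) := by
  have key : ∀ v ∈ F, position (F.erase v) v = position F v := by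
    intro v _
    unfold position
    congr 1
    ext u
    simp only [Finset.mem_filter, Finset.mem_erase]
    exact ⟨fun h => ⟨h.1.2, h.2⟩, fun h => ⟨⟨h.2.ne, h.1⟩, h.2⟩⟩
  funext G
  change ∑ v ∈ Gᶜ, (-1 : K) ^ position G v * (Pi.single F 1 : Finset V → K) (insert v G) = _
  rw [Finset.sum_apply]
  have h1 : ∀ v, v ∈ Gᶜ ∧ insert v G = F ↔ v ∈ F ∧ G = F.erase v := by
    intro v
    rw [Finset.mem_compl]
    constructor
    · rintro ⟨hv, rfl⟩
      exact ⟨Finset.mem_insert_self _ _, (Finset.erase_insert hv).symm⟩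
    · rintro ⟨hv, rfl⟩
      exact ⟨Finset.notMem_erase _ _, Finset.insert_erase hv⟩
  simp only [Pi.smul_apply, Pi.single_apply, smul_eq_mul, mul_ite, mul_one, mul_zero]
  rw [← Finset.sum_filter, ← Finset.sum_filter]
  refine Finset.sum_congr ?_ ?_
  · ext v
    rw [Finset.mem_filter, Finset.mem_filter]
    exact h1 v
  · intro v hv
    rw [Finset.mem_filter] at hv
    rw [hv.2, key v hv.1]

theorem position_insert {V : Type*} [LinearOrder V] {G : Finset V} {v w : V}
    (hv : v ∉ G) (h : v < w) :
    position (insert v G) w = position G w + 1 ∧ position (insert w G) v = position G v := by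
  unfold position
  rw [Finset.filter_insert, if_pos h, Finset.filter_insert, if_neg h.asymm]
  exact ⟨Finset.card_insert_of_notMem (by simp [hv]), rfl⟩

theorem boundary_boundary {K : Type*} [Field K] {V : Type*} [Fintype V] [LinearOrder V]
    (c : Finset V → K) : boundary K V (boundary K V c) = 0 := by
  funext G
  change ∑ v ∈ Gᶜ, (-1 : K) ^ position G v * (∑ w ∈ (insert v G)ᶜ,
    (-1 : K) ^ position (insert v G) w * c (insert w (insert v G))) = 0
  simp only [Finset.mul_sum]
  rw [Finset.sum_sigma']
  refine Finset.sum_involution (fun q _ => ⟨q.2, q.1⟩) ?_ ?_ ?_ ?_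
  · rintro ⟨v, w⟩ h
    simp only [Finset.mem_sigma, Finset.mem_compl, Finset.mem_insert, not_or] at h
    obtain ⟨hv, hwv, hw⟩ := h
    dsimp only
    rw [Finset.insert_comm v w]
    rcases lt_or_gt_of_ne hwv with hlt | hlt
    · obtain ⟨h1, h2⟩ := position_insert hw hlt
      rw [h1, h2]; ring
    · obtain ⟨h1, h2⟩ := position_insert hv hlt
      rw [h1, h2]; ring
  · rintro ⟨v, w⟩ h _ he
    simp only [Finset.mem_sigma, Finset.mem_compl, Finset.mem_insert, not_or] at h
    simp only [Sigma.mk.injEq] at he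
    exact h.2.1 he.1
  · rintro ⟨v, w⟩ h
    simp only [Finset.mem_sigma, Finset.mem_compl, Finset.mem_insert, not_or] at h ⊢
    exact ⟨h.2.2, Ne.symm h.2.1, h.1⟩
  · rintro ⟨v, w⟩ _
    rfl

theorem boundaries_le_cycles (K : Type*) [Field K] {V : Type*} [Fintype V] [LinearOrder V]
    (Δ : LowerSet (Finset V)) (i : ℤ) : boundaries K Δ i ≤ cycles K Δ i := by
  rintro _ ⟨c, hc, rfl⟩
  refine ⟨?_, boundary_boundary c⟩
  intro G hG
  obtain ⟨v, hv, hne⟩ := Finset.exists_ne_zero_of_sum_ne_zero hG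
  obtain ⟨h1, h2⟩ := hc (insert v G) (right_ne_zero_of_mul hne)
  refine ⟨Δ.lower (Finset.subset_insert v G) h1, ?_⟩
  rw [Finset.card_insert_of_notMem (Finset.mem_compl.1 hv)] at h2
  push_cast at h2
  linarith

/-! # Path complexes of cycles, and runs

Vertices and facets are counted from `0`: the vertex `x_{a+1}` and the facet `F_{i+1}` of the usual
`1`-based notation are the vertex `a` and the facet `i` here. -/

/-- The facet `i` of `Δ_{m,l}(C_n)`: the vertices `i l, i l + 1, …, i l + m - 1` modulo `n`. -/
def cycleFacet (n l m : ℕ) (i : ℕ) : Finset (Fin n) :=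
  Finset.univ.filter (fun v => ∃ a < m, (v : ℕ) = (i * l + a) % n)

/-- The path complex `Δ_{m,l}(C_n)` of the `n`-cycle, for a divisor `l` of `n`; it is generated by
the facets `0, …, n / l - 1`. -/
def cyclePathComplex (n l m : ℕ) : LowerSet (Finset (Fin n)) :=
  generated {F | ∃ i < n / l, F = cycleFacet n l m i}

/-- The facet `i` of the path complex of a line whose vertices are labelled
`x 0, x 1, x 2, …`, in this order: the set `{x (i l), x (i l + 1), …, x (i l + m - 1)}`. -/
def runFacet {V : Type*} [DecidableEq V] (l m : ℕ) (x : ℕ → V) (i : ℕ) : Finset V :=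
  (Finset.Ico (i * l) (i * l + m)).image x

/-- `R` is a run of length `q ≥ 1` with standard labelling `x`: the labels
`x 0, …, x ((q - 1) l + m - 1)` are distinct vertices, and `R` is the path complex
`Δ_{m,l}(L_{q l + (m - l)})` of the line they form, with the facets `0, …, q - 1`.
The values of `x` outside this range play no role. -/
structure IsRun {V : Type*} [DecidableEq V] (l m q : ℕ) (x : ℕ → V)
    (R : LowerSet (Finset V)) : Prop where
  pos : 0 < q
  injOn : Set.InjOn x (Set.Iio ((q - 1) * l + m))
  eq : R = generated {F | ∃ i < q, F = runFacet l m x i}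

/-- `Γ` is the disjoint union of the runs `R 0, …, R (r - 1)` of lengths `len 0, …, len (r - 1)`,
with standard labellings `x 0, …, x (r - 1)`.  For `0 < l < m` consecutive facets of a run meet, so
runs are connected and the `R j` are exactly the connected components of `Γ`. -/
structure IsDisjointUnionOfRuns {V : Type*} [Fintype V] [DecidableEq V] (l m : ℕ)
    (Γ : LowerSet (Finset V)) {r : ℕ} (R : Fin r → LowerSet (Finset V)) (len : Fin r → ℕ)
    (x : Fin r → ℕ → V) : Prop where
  isRun : ∀ j, IsRun l m (len j) (x j) (R j)
  disjoint : ∀ j j', j ≠ j' → Disjoint (vertexSet (R j)) (vertexSet (R j'))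
  union : Γ = ⨆ j, R j

/-- The facets of all the components `R j'` other than `R j`. -/
def otherFacets {V : Type*} {r : ℕ} (R : Fin r → LowerSet (Finset V)) (j : Fin r) :
    Set (Finset V) :=
  {F | ∃ j', j' ≠ j ∧ F ∈ facets (R j')}

/-- The vertex set of the subcollection formed by the front (that is, first) `b` facets of the run
labelled by `x`. -/
def frontVertices {V : Type*} [DecidableEq V] (l m : ℕ) (x : ℕ → V) (b : ℕ) : Finset V :=
  (Finset.range b).biUnion (runFacet l m x)

end PathRuns

set_option linter.unusedSectionVars false


namespace PathRuns

/-! # Cones -/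

section Cone

variable {K : Type*} [Field K] {V : Type*} [Fintype V] [LinearOrder V]

/-! A subset of `W` fails to be a face of the complement complex exactly when it meets every member
of `𝓕`. These transversals span the relative chains of the pair formed by the simplex on `W` and the
complement complex. Since `W` is nonempty, the simplex is acyclic, so the connecting map identifies
reduced homology with the homology of transversals one degree higher
(`nonempty_transversals_equiv`).

Suppose a vertex `v` of `W` lies in `F` and in no other member. Match the transversals `G` and `G ∪
{v}`. The only unmatched ones are `{v} ∪ H` with `H ⊆ W \ F` meeting every other member. Hence `F`
and its vertices can be deleted at the cost of one degree (`nonempty_transversals_insert_equiv`). If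
a vertex of `W` lies in no member at all, everything is matched and the homology vanishes
(`subsingleton_familyHomology`).

For a run, delete the first facet `c`. What survives of facet `c + 1` is contained in the facets `c
+ 2, …, c + t`, which become redundant; its first surviving label lies in no facet from `c + t + 1`
on, so it can be deleted too. Thus `t + 1` facets disappear for two degrees
(`nonempty_remove_front_equiv`), and the remaining run has the same shape except for its first `s <
l` labels, which are harmless. A final group of one or two facets is deleted without a remainder. A
final group of three or more leaves labels that lie in no remaining facet, which gives the vanishing
(`subsingleton_of_last_group`). -/

theorem boundary_apply (c : Finset V → K) (G : Finset V) :
    boundary K V c G = ∑ v ∈ Gᶜ, (-1 : K) ^ position G v * c (insert v G) := rfl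

theorem exists_of_boundary_ne_zero {c : Finset V → K} {G : Finset V}
    (h : boundary K V c G ≠ 0) : ∃ v, v ∉ G ∧ c (insert v G) ≠ 0 := by
  obtain ⟨v, hv, hne⟩ := Finset.exists_ne_zero_of_sum_ne_zero h
  exact ⟨v, Finset.mem_compl.1 hv, right_ne_zero_of_mul hne⟩

theorem boundary_congr {c c' : Finset V → K} {G : Finset V}
    (h : ∀ v ∉ G, c (insert v G) = c' (insert v G)) :
    boundary K V c G = boundary K V c' G := by
  rw [boundary_apply, boundary_apply]
  exact Finset.sum_congr rfl fun v hv => by rw [h v (Finset.mem_compl.1 hv)]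

variable (K) in
/-- The cone operator `c ↦ v ∗ c`. -/
def cone (v : V) : (Finset V → K) →ₗ[K] (Finset V → K) where
  toFun c G := if v ∈ G then (-1 : K) ^ position (G.erase v) v * c (G.erase v) else 0
  map_add' c c' := by
    funext G
    by_cases h : v ∈ G <;> simp [h, mul_add]
  map_smul' a c := by
    funext G
    by_cases h : v ∈ G
    · simp only [h, if_true, Pi.smul_apply, smul_eq_mul, RingHom.id_apply]
      ring
    · simp [h]

theorem cone_of_notMem {v : V} {G : Finset V} (h : v ∉ G) (c : Finset V → K) :
    cone K v c G = 0 := if_neg h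

theorem cone_of_mem {v : V} {G : Finset V} (h : v ∈ G) (c : Finset V → K) :
    cone K v c G = (-1 : K) ^ position (G.erase v) v * c (G.erase v) := if_pos h

theorem cone_insert {v : V} {G : Finset V} (h : v ∉ G) (c : Finset V → K) :
    cone K v c (insert v G) = (-1 : K) ^ position G v * c G := by
  rw [cone_of_mem (Finset.mem_insert_self _ _), Finset.erase_insert h]

theorem cone_ne_zero {v : V} {G : Finset V} {c : Finset V → K} (h : cone K v c G ≠ 0) :
    v ∈ G ∧ c (G.erase v) ≠ 0 := by
  by_cases hv : v ∈ G
  · rw [cone_of_mem hv] at h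
    exact ⟨hv, right_ne_zero_of_mul h⟩
  · exact absurd (cone_of_notMem hv c) h

/-- The cone operator is a contracting homotopy of the full simplex. -/
theorem boundary_cone (v : V) (c : Finset V → K) (G : Finset V) :
    boundary K V (cone K v c) G + cone K v (boundary K V c) G = c G := by
  have sq : ∀ k : ℕ, (-1 : K) ^ k * (-1 : K) ^ k = 1 := fun k => by
    rw [← mul_pow]; simp
  by_cases hv : v ∈ G
  · obtain ⟨H, hH, rfl⟩ : ∃ H, v ∉ H ∧ G = insert v H :=
      ⟨G.erase v, Finset.notMem_erase _ _, (Finset.insert_erase hv).symm⟩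
    rw [cone_insert hH, boundary_apply, boundary_apply, Finset.mul_sum]
    -- The summand at `v` yields `c (insert v H)`; every other one cancels in pairs, because
    -- inserting the smaller of two vertices shifts the position of the larger by one.
    have hc : Hᶜ = insert v (insert v H)ᶜ := by
      ext u
      by_cases hu : u = v
      · subst hu; simp [hH]
      · simp [hu]
    rw [hc, Finset.sum_insert (by simp), ← mul_assoc, sq, one_mul, add_left_comm,
      ← Finset.sum_add_distrib, Finset.sum_eq_zero, add_zero]
    intro u hu
    simp only [Finset.mem_compl, Finset.mem_insert, not_or] at hu
    rw [Finset.insert_comm u v, cone_insert (by simp [Ne.symm hu.1, hH])]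
    rcases lt_or_gt_of_ne hu.1 with hlt | hlt
    · obtain ⟨h1, h2⟩ := position_insert hu.2 hlt
      rw [h1, h2]; ring
    · obtain ⟨h1, h2⟩ := position_insert hH hlt
      rw [h1, h2]; ring
  · rw [cone_of_notMem hv, add_zero, boundary_apply, Finset.sum_eq_single v]
    · rw [cone_insert hv, ← mul_assoc, sq, one_mul]
    · intro u _ huv
      rw [cone_of_notMem (by simp [hv, Ne.symm huv]), mul_zero]
    · intro h
      exact absurd (Finset.mem_compl.2 hv) h

theorem boundary_cone_eq (v : V) (c : Finset V → K) (G : Finset V) :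
    boundary K V (cone K v c) G = c G - cone K v (boundary K V c) G :=
  eq_sub_of_add_eq (boundary_cone v c G)

/-- A chain supported on faces containing `v` is a cone with apex `v`. -/
theorem exists_cone_eq {v : V} {e : Finset V → K} (he : ∀ G, e G ≠ 0 → v ∈ G) :
    ∃ c, cone K v c = e ∧ ∀ G, c G ≠ 0 → v ∉ G ∧ e (insert v G) ≠ 0 := by
  refine ⟨fun G => if v ∈ G then 0 else (-1 : K) ^ position G v * e (insert v G), ?_, ?_⟩
  · funext G
    by_cases hv : v ∈ G
    · rw [cone_of_mem hv, if_neg (Finset.notMem_erase _ _), ← mul_assoc, ← mul_pow,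
        Finset.insert_erase hv]
      simp
    · rw [cone_of_notMem hv]
      by_contra h
      exact hv (he G (Ne.symm h))
  · intro G hG
    by_cases hv : v ∈ G
    · simp [hv] at hG
    · dsimp only at hG
      rw [if_neg hv] at hG
      exact ⟨hv, right_ne_zero_of_mul hG⟩

end Cone

/-! # Homology of a convex family of faces -/

section Relative

variable (K : Type*) [Field K] {V : Type*} [Fintype V] [LinearOrder V]

/-- Chains of degree `i` supported on a family of faces. -/
def familyChains (X : Set (Finset V)) (i : ℤ) : Submodule K (Finset V → K) where
  carrier := {c | ∀ F, c F ≠ 0 → F ∈ X ∧ (F.card : ℤ) = i + 1}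
  zero_mem' F h := absurd rfl h
  add_mem' {c c'} hc hc' F h := by
    by_cases h0 : c F = 0
    · exact hc' F (fun h1 => h (by simp [h0, h1]))
    · exact hc F h0
  smul_mem' a c hc F h := hc F (fun h0 => h (by simp [h0]))

/-- Chains on a family `X` whose boundary vanishes on `X`. -/
def familyCycles (X : Set (Finset V)) (i : ℤ) : Submodule K (Finset V → K) where
  carrier := {c | c ∈ familyChains K X i ∧ ∀ G ∈ X, boundary K V c G = 0}
  zero_mem' := ⟨zero_mem _, fun G _ => by simp⟩
  add_mem' hc hc' := ⟨add_mem hc.1 hc'.1, fun G hG => by simp [hc.2 G hG, hc'.2 G hG]⟩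
  smul_mem' a _ hc := ⟨Submodule.smul_mem _ a hc.1, fun G hG => by simp [hc.2 G hG]⟩

/-- Chains on a family `X` that agree on `X` with the boundary of a chain on `X`. -/
def familyBoundaries (X : Set (Finset V)) (i : ℤ) : Submodule K (Finset V → K) where
  carrier := {c | c ∈ familyChains K X i ∧
    ∃ e ∈ familyChains K X (i + 1), ∀ G ∈ X, boundary K V e G = c G}
  zero_mem' := ⟨zero_mem _, 0, zero_mem _, fun G _ => by simp⟩
  add_mem' := by
    rintro c c' ⟨hc, e, he, h⟩ ⟨hc', e', he', h'⟩
    exact ⟨add_mem hc hc', e + e', add_mem he he', fun G hG => by simp [h G hG, h' G hG]⟩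
  smul_mem' := by
    rintro a c ⟨hc, e, he, h⟩
    exact ⟨Submodule.smul_mem _ a hc, a • e, Submodule.smul_mem _ a he,
      fun G hG => by simp [h G hG]⟩

/-- The homology of the chain complex spanned by a convex family of faces. -/
abbrev FamilyHomology (X : Set (Finset V)) (i : ℤ) : Type _ :=
  familyCycles K X i ⧸ (familyBoundaries K X i).submoduleOf (familyCycles K X i)

end Relative

/-- A criterion for a linear map to induce an isomorphism of subquotients. -/
theorem nonempty_subquotient_equiv {K M N : Type*} [Field K] [AddCommGroup M] [Module K M]
    [AddCommGroup N] [Module K N] {Z B : Submodule K M} {Z' B' : Submodule K N}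
    (f : M →ₗ[K] N) (hZ : ∀ z ∈ Z, f z ∈ Z') (hB : ∀ z ∈ Z, f z ∈ B' ↔ z ∈ B)
    (hs : ∀ z' ∈ Z', ∃ z ∈ Z, f z - z' ∈ B') :
    Nonempty ((Z ⧸ B.submoduleOf Z) ≃ₗ[K] (Z' ⧸ B'.submoduleOf Z')) := by
  let g : Z →ₗ[K] Z' := f.restrict hZ
  have hg : B.submoduleOf Z = (B'.submoduleOf Z').comap g := by
    ext z
    exact (hB z z.2).symm
  let φ := Submodule.mapQ (B.submoduleOf Z) (B'.submoduleOf Z') g hg.le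
  refine ⟨LinearEquiv.ofBijective φ ⟨?_, ?_⟩⟩
  · rw [← LinearMap.ker_eq_bot, LinearMap.ker_eq_bot']
    intro y hy
    obtain ⟨z, rfl⟩ := Submodule.Quotient.mk_surjective _ y
    rw [Submodule.mapQ_apply, Submodule.Quotient.mk_eq_zero] at hy
    rw [Submodule.Quotient.mk_eq_zero, hg]
    exact hy
  · intro y
    obtain ⟨z', rfl⟩ := Submodule.Quotient.mk_surjective _ y
    obtain ⟨z, hz, h⟩ := hs z' z'.2
    refine ⟨Submodule.Quotient.mk ⟨z, hz⟩, ?_⟩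
    rw [Submodule.mapQ_apply, Submodule.Quotient.eq]
    exact h

/-! ### Transversals and complement complexes -/

section FamilyLemmas

variable {K : Type*} [Field K] {V : Type*} [Fintype V] [LinearOrder V]

theorem boundary_degree {X : Set (Finset V)} {i : ℤ} {e : Finset V → K}
    (he : e ∈ familyChains K X (i + 1)) {G : Finset V} (h : boundary K V e G ≠ 0) :
    (∃ v ∉ G, insert v G ∈ X) ∧ (G.card : ℤ) = i + 1 := by
  obtain ⟨v, hv, hne⟩ := exists_of_boundary_ne_zero h
  obtain ⟨h1, h2⟩ := he _ hne
  rw [Finset.card_insert_of_notMem hv] at h2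
  push_cast at h2
  exact ⟨⟨v, hv, h1⟩, by linarith⟩

theorem cone_degree {X : Set (Finset V)} {i : ℤ} {v : V} {c : Finset V → K}
    (hc : c ∈ familyChains K X i) {G : Finset V} (h : cone K v c G ≠ 0) :
    v ∈ G ∧ G.erase v ∈ X ∧ (G.card : ℤ) = i + 1 + 1 := by
  obtain ⟨hv, hne⟩ := cone_ne_zero h
  obtain ⟨h1, h2⟩ := hc _ hne
  refine ⟨hv, h1, ?_⟩
  have := Finset.card_erase_add_one hv
  rw [← h2]
  exact_mod_cast this.symm

theorem indicator_mem_familyChains {X : Set (Finset V)} {i : ℤ} {c : Finset V → K}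
    (hc : ∀ G ∈ X, c G ≠ 0 → (G.card : ℤ) = i + 1) : X.indicator c ∈ familyChains K X i := by
  intro G hG
  have hX : G ∈ X := Set.mem_of_indicator_ne_zero hG
  rw [Set.indicator_of_mem hX] at hG
  exact ⟨hX, hc G hX hG⟩

/-- The faces of `W` that meet every member of `𝓕`. -/
def transversals (W : Finset V) (𝓕 : Set (Finset V)) : Set (Finset V) :=
  {G | G ⊆ W ∧ ∀ F ∈ 𝓕, ¬ Disjoint G F}

theorem mem_transversals_mono {W : Finset V} {𝓕 : Set (Finset V)} {G H : Finset V}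
    (hG : G ∈ transversals W 𝓕) (h : G ⊆ H) (hH : H ⊆ W) : H ∈ transversals W 𝓕 :=
  ⟨hH, fun F hF hd => hG.2 F hF (hd.mono_left h)⟩

/-- If some vertex lies in no member of `𝓕`, the transversals are acyclic. -/
theorem subsingleton_familyHomology {W : Finset V} {𝓕 : Set (Finset V)} {u : V} (hu : u ∈ W)
    (h𝓕 : ∀ F ∈ 𝓕, u ∉ F) (i : ℤ) :
    Subsingleton (FamilyHomology K (transversals W 𝓕) i) := by
  rw [Submodule.Quotient.subsingleton_iff, Submodule.submoduleOf_eq_top]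
  rintro z ⟨hz, hz0⟩
  refine ⟨hz, cone K u z, ?_, ?_⟩
  · intro G hG
    obtain ⟨huG, h1, h2⟩ := cone_degree hz hG
    refine ⟨mem_transversals_mono h1 (Finset.erase_subset _ _) ?_, h2⟩
    intro w hw
    by_cases hwu : w = u
    · exact hwu ▸ hu
    · exact h1.1 (Finset.mem_erase.2 ⟨hwu, hw⟩)
  · intro G hG
    rw [boundary_cone_eq, sub_eq_self]
    by_contra h
    obtain ⟨huG, h1⟩ := cone_ne_zero h
    -- Erasing `u` keeps a transversal a transversal, so the boundary of `z` vanishes there.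
    refine h1 (hz0 _ ⟨(Finset.erase_subset _ _).trans hG.1, fun F hF hd => hG.2 F hF ?_⟩)
    rw [Finset.disjoint_left] at hd ⊢
    intro w hw hwF
    refine hd (Finset.mem_erase.2 ⟨?_, hw⟩) hwF
    rintro rfl
    exact h𝓕 F hF hwF

theorem mem_complementComplex {W : Finset V} {𝓕 : Set (Finset V)} {G : Finset V} :
    G ∈ complementComplex W 𝓕 ↔ G ⊆ W ∧ ∃ F ∈ 𝓕, Disjoint G F := by
  unfold complementComplex generated
  rw [mem_lowerClosure]
  constructor
  · rintro ⟨_, ⟨F, hF, rfl⟩, hG⟩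
    have hG' : G ⊆ W \ F := hG
    rw [Finset.subset_sdiff] at hG'
    exact ⟨hG'.1, F, hF, hG'.2⟩
  · rintro ⟨hG, F, hF, hd⟩
    exact ⟨_, ⟨F, hF, rfl⟩, Finset.subset_sdiff.2 ⟨hG, hd⟩⟩

/-- Missing some member of `𝓕` and meeting all of them are complementary conditions; this splits
chains of the simplex on `W` into an absolute and a relative part. -/
theorem mem_complementComplex_or_mem_transversals {W : Finset V} {𝓕 : Set (Finset V)}
    {G : Finset V} (hG : G ⊆ W) : G ∈ complementComplex W 𝓕 ∨ G ∈ transversals W 𝓕 := by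
  rw [mem_complementComplex]
  by_cases h : ∃ F ∈ 𝓕, Disjoint G F
  · exact Or.inl ⟨hG, h⟩
  · push Not at h
    exact Or.inr ⟨hG, h⟩

theorem notMem_complementComplex {W : Finset V} {𝓕 : Set (Finset V)}
    {G : Finset V} (hG : G ∈ transversals W 𝓕) : G ∉ complementComplex W 𝓕 := by
  rw [mem_complementComplex]
  rintro ⟨_, F, hF, hd⟩
  exact hG.2 F hF hd

/-- The connecting isomorphism of the pair formed by the full simplex on `W` and the
complement complex. -/
theorem nonempty_transversals_equiv {W : Finset V} (hW : W.Nonempty) (𝓕 : Set (Finset V))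
    (i : ℤ) :
    Nonempty (ReducedHomology K (complementComplex W 𝓕) i ≃ₗ[K]
      FamilyHomology K (transversals W 𝓕) (i + 1)) := by
  obtain ⟨w, hw⟩ := hW
  set T := transversals W 𝓕 with hT
  set D := complementComplex W 𝓕 with hD
  have hTW : ∀ {G}, G ∈ T → G ⊆ W := fun h => h.1
  have hDW : ∀ {G}, G ∈ D → G ⊆ W := fun h => (mem_complementComplex.1 h).1
  have hDT : ∀ {G}, G ∈ T → G ∉ D := notMem_complementComplex
  have hor : ∀ {G}, G ⊆ W → G ∈ D ∨ G ∈ T := mem_complementComplex_or_mem_transversals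
  have hDlow : ∀ {G H : Finset V}, G ⊆ H → H ∈ D → G ∈ D := fun h h' => D.lower h h'
  have hwW : ∀ {G : Finset V}, G.erase w ⊆ W → G ⊆ W := by
    intro G hG u hu
    by_cases h : u = w
    · exact h ▸ hw
    · exact hG (Finset.mem_erase.2 ⟨h, hu⟩)
  -- chains supported in `W` split into a part in `T` and a part in `D`
  have split : ∀ (k : ℤ) (c : Finset V → K), (∀ G, c G ≠ 0 → G ⊆ W ∧ (G.card : ℤ) = k + 1) →
      ∃ a ∈ familyChains K T k, ∃ b ∈ chains K D k, a + b = c := by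
    intro k c hc
    refine ⟨T.indicator c, indicator_mem_familyChains fun G _ h => (hc G h).2,
      c - T.indicator c, ?_, by abel⟩
    intro G hG
    by_cases h : G ∈ T
    · simp [h] at hG
    · rw [Pi.sub_apply, Set.indicator_of_notMem h, sub_zero] at hG
      exact ⟨(hor (hc G hG).1).resolve_right h, (hc G hG).2⟩
  have bD : ∀ {k : ℤ} {b : Finset V → K}, b ∈ chains K D k → ∀ G ∈ T, boundary K V b G = 0 := by
    intro k b hb G hG
    by_contra h
    obtain ⟨v, -, hne⟩ := exists_of_boundary_ne_zero h
    exact hDT hG (hDlow (Finset.subset_insert _ _) (hb _ hne).1)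
  have zD : ∀ {k : ℤ} {b : Finset V → K}, b ∈ chains K D k → ∀ G ∈ T, b G = 0 := by
    intro k b hb G hG
    by_contra h
    exact hDT hG (hb _ h).1
  suffices h : Nonempty (FamilyHomology K T (i + 1) ≃ₗ[K] ReducedHomology K D i) from
    h.map LinearEquiv.symm
  refine nonempty_subquotient_equiv (boundary K V) ?_ ?_ ?_
  · rintro z ⟨hz, hz0⟩
    refine ⟨fun G hG => ?_, boundary_boundary z⟩
    obtain ⟨⟨v, hv, hX⟩, hcard⟩ := boundary_degree hz hG
    have hGW : G ⊆ W := (Finset.subset_insert v G).trans (hTW hX)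
    exact ⟨(hor hGW).resolve_right fun h => hG (hz0 G h), hcard⟩
  · rintro z ⟨hz, hz0⟩
    constructor
    · rintro ⟨y, hy, hyz⟩
      refine ⟨hz, ?_⟩
      -- The cycle `z - y` bounds its cone from `w`. The part of that cone on `D` is invisible on
      -- `T`, since `D` is closed under subsets.
      have hcyc : boundary K V (z - y) = 0 := by rw [map_sub, hyz, sub_self]
      have hzy : z - y ∈ familyChains K {G | G ⊆ W} (i + 1) := by
        refine sub_mem (fun G hG => ?_) (fun G hG => ?_)
        · exact ⟨hTW (hz G hG).1, (hz G hG).2⟩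
        · exact ⟨hDW (hy G hG).1, (hy G hG).2⟩
      obtain ⟨a, ha, b, hb, hab⟩ := split (i + 1 + 1) (cone K w (z - y)) (fun G hG => by
        obtain ⟨-, h1, h2⟩ := cone_degree hzy hG
        exact ⟨hwW h1, h2⟩)
      refine ⟨a, ha, fun G hG => ?_⟩
      have h1 := boundary_cone w (z - y) G
      rw [hcyc, ← hab, map_add, map_zero, Pi.add_apply, bD hb G hG, Pi.sub_apply, zD hy G hG] at h1
      simpa using h1
    · rintro ⟨-, e, he, hez⟩
      -- The boundary of `e` is `z + b` with `b` on `D`; applying the boundary again shows that `z`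
      -- and `-b` have the same boundary.
      obtain ⟨a, ha, b, hb, hab⟩ := split (i + 1) (boundary K V e) (fun G hG => by
        obtain ⟨⟨v, hv, hX⟩, hcard⟩ := boundary_degree he hG
        exact ⟨(Finset.subset_insert v G).trans (hTW hX), hcard⟩)
      have haz : a = z := by
        funext G
        by_cases hG : G ∈ T
        · rw [← hez G hG, ← hab, Pi.add_apply, zD hb G hG, add_zero]
        · rw [not_not.1 fun h => hG (ha G h).1, not_not.1 fun h => hG (hz G h).1]
      refine ⟨-b, neg_mem hb, ?_⟩
      have h := boundary_boundary e
      rw [← hab, haz, map_add] at h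
      rw [map_neg, neg_eq_iff_add_eq_zero, add_comm]
      exact h
  · rintro y ⟨hy, hy0⟩
    have hy0' : boundary K V y = 0 := hy0
    have hyW : y ∈ familyChains K {G | G ⊆ W} i := fun G hG => ⟨hDW (hy G hG).1, (hy G hG).2⟩
    -- The preimage of `y` is the part on `T` of its cone from `w`.
    obtain ⟨a, ha, b, hb, hab⟩ := split (i + 1) (cone K w y) (fun G hG => by
      obtain ⟨-, h1, h2⟩ := cone_degree hyW hG
      exact ⟨hwW h1, h2⟩)
    have hby : boundary K V a + boundary K V b = y := by
      rw [← map_add, hab]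
      funext G
      have h1 := boundary_cone w y G
      rw [hy0', map_zero] at h1
      simpa using h1
    refine ⟨a, ⟨ha, fun G hG => ?_⟩, -b, neg_mem hb, ?_⟩
    · have := congrFun hby G
      rwa [Pi.add_apply, bD hb G hG, zD hy G hG, add_zero] at this
    · rw [map_neg, ← hby]
      abel

/-- A chain on the transversals whose boundary vanishes on the faces `G ∌ v` is homologous to
one supported on faces that meet `F` in `v` only. -/
theorem exists_homologous_supported {W F : Finset V} {𝓕 : Set (Finset V)} {v : V}
    (hvF : v ∈ F) (hvW : v ∈ W) (hv : ∀ F' ∈ 𝓕, v ∉ F') {k : ℤ} {z : Finset V → K}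
    (hz : z ∈ familyChains K (transversals W (insert F 𝓕)) k)
    (hz0 : ∀ G ∈ transversals W (insert F 𝓕), v ∉ G → boundary K V z G = 0) :
    ∃ e ∈ familyChains K (transversals W (insert F 𝓕)) (k + 1),
    ∃ z' ∈ familyChains K (transversals W (insert F 𝓕)) k,
      (∀ G ∈ transversals W (insert F 𝓕), z' G = z G - boundary K V e G) ∧
      (∀ G ∈ transversals W (insert F 𝓕), boundary K V z' G = boundary K V z G) ∧
      ∀ G, z' G ≠ 0 → v ∈ G ∧ G.erase v ∈ transversals (W \ F) 𝓕 := by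
  set T := transversals W (insert F 𝓕) with hT
  set A : Set (Finset V) := {G | G ∈ T ∧ v ∉ G} with hA
  have hins : ∀ {G : Finset V}, G ∈ T → insert v G ∈ T := fun hG =>
    mem_transversals_mono hG (Finset.subset_insert _ _) (Finset.insert_subset hvW hG.1)
  have he : cone K v (A.indicator z) ∈ familyChains K T (k + 1) := by
    intro G hG
    have hc : A.indicator z ∈ familyChains K A k :=
      indicator_mem_familyChains fun G _ h => (hz G h).2
    obtain ⟨h1, h2, h3⟩ := cone_degree hc hG
    refine ⟨?_, h3⟩
    have := hins h2.1
    rwa [Finset.insert_erase h1] at this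
  set e := cone K v (A.indicator z) with hedef
  have hz'mem : T.indicator (z - boundary K V e) ∈ familyChains K T k := by
    refine indicator_mem_familyChains fun G _ h => ?_
    by_cases h0 : z G = 0
    · rw [Pi.sub_apply, h0, zero_sub, neg_ne_zero] at h
      exact (boundary_degree he h).2
    · exact (hz G h0).2
  set z' := T.indicator (z - boundary K V e) with hz'def
  have hz'T : ∀ G ∈ T, z' G = z G - boundary K V e G := fun G hG => by
    rw [hz'def, Set.indicator_of_mem hG, Pi.sub_apply]
  have hbd : ∀ G ∈ T, boundary K V z' G = boundary K V z G := by
    intro G hG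
    -- `T` is closed under supersets inside `W`, and both chains vanish on faces not contained in
    -- `W`; so truncating to `T` changes no boundary coefficient at `G`.
    have h1 : boundary K V z' G = boundary K V (z - boundary K V e) G := by
      refine boundary_congr fun u hu => ?_
      by_cases hin : insert u G ∈ T
      · rw [hz'def, Set.indicator_of_mem hin]
      · have hWu : ¬ insert u G ⊆ W := fun h =>
          hin (mem_transversals_mono hG (Finset.subset_insert _ _) h)
        rw [hz'def, Set.indicator_of_notMem hin, Pi.sub_apply,
          not_not.1 fun h => hin (hz _ h).1, zero_sub, eq_comm, neg_eq_zero]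
        by_contra h
        obtain ⟨⟨w, -, hX⟩, -⟩ := boundary_degree he h
        exact hWu ((Finset.subset_insert _ _).trans hX.1)
    rw [h1, map_sub, boundary_boundary, sub_zero]
  have hzA : ∀ G ∈ A, z' G = 0 := by
    rintro G ⟨hG, hvG⟩
    rw [hz'T G hG, hedef, boundary_cone_eq, cone_of_notMem hvG,
      Set.indicator_of_mem (show G ∈ A from ⟨hG, hvG⟩)]
    ring
  refine ⟨e, he, z', hz'mem, hz'T, hbd, ?_⟩
  intro G hG
  have hGT : G ∈ T := (hz'mem G hG).1
  have hvG : v ∈ G := by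
    by_contra h
    exact hG (hzA G ⟨hGT, h⟩)
  refine ⟨hvG, ?_⟩
  have h𝓕 : ∀ F' ∈ 𝓕, ¬ Disjoint (G.erase v) F' := by
    intro F' hF' hd
    refine hGT.2 F' (Set.mem_insert_of_mem _ hF') ?_
    rw [Finset.disjoint_left] at hd ⊢
    intro w hw hwF
    refine hd (Finset.mem_erase.2 ⟨?_, hw⟩) hwF
    rintro rfl
    exact hv F' hF' hwF
  have hGW : G.erase v ⊆ W := (Finset.erase_subset _ _).trans hGT.1
  refine ⟨Finset.subset_sdiff.2 ⟨hGW, ?_⟩, h𝓕⟩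
  by_contra hd
  have hET : G.erase v ∈ T := by
    refine ⟨hGW, fun F' hF' => ?_⟩
    rcases hF' with rfl | hF'
    · exact hd
    · exact h𝓕 F' hF'
  apply hG
  -- If `G` without `v` were still in `T`, the homotopy formula would express `z' G` through a
  -- boundary coefficient that vanishes and values of `z'` on faces in `A`, which vanish as well.
  have h1 : cone K v (boundary K V z') G = 0 := by
    rw [cone_of_mem hvG, hbd _ hET, hz0 _ hET (Finset.notMem_erase _ _), mul_zero]
  have h2 := boundary_cone v z' G
  rw [h1, add_zero] at h2
  rw [← h2]
  by_contra h
  obtain ⟨u, hu, hne⟩ := exists_of_boundary_ne_zero h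
  obtain ⟨-, hne⟩ := cone_ne_zero hne
  have huv : u ≠ v := fun h => hu (h ▸ hvG)
  refine hne (hzA _ ⟨?_, Finset.notMem_erase _ _⟩)
  refine mem_transversals_mono hET (Finset.erase_subset_erase _ (Finset.subset_insert _ _)) ?_
  exact (hz'mem _ hne).1.1

/-- If the vertex `v` of `W` lies in `F` and in no member of `𝓕`, then `F` can be removed at the
cost of a shift in degree. -/
theorem nonempty_transversals_insert_equiv {W F : Finset V} {𝓕 : Set (Finset V)} {v : V}
    (hvF : v ∈ F) (hvW : v ∈ W) (hv : ∀ F' ∈ 𝓕, v ∉ F') (i : ℤ) :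
    Nonempty (FamilyHomology K (transversals W (insert F 𝓕)) (i + 1) ≃ₗ[K]
      FamilyHomology K (transversals (W \ F) 𝓕) i) := by
  set T := transversals W (insert F 𝓕) with hT
  set T' := transversals (W \ F) 𝓕 with hT'
  have hTT' : ∀ {G}, G ∈ T → G ∉ T' := fun h h' =>
    h.2 F (Set.mem_insert _ _) (Finset.subset_sdiff.1 h'.1).2
  have hvT' : ∀ {G}, G ∈ T' → v ∉ G := fun h hvG =>
    (Finset.mem_sdiff.1 (h.1 hvG)).2 hvF
  have hins : ∀ {G}, G ∈ T' → insert v G ∈ T := by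
    intro G hG
    have hGW := (Finset.subset_sdiff.1 hG.1).1
    refine ⟨Finset.insert_subset hvW hGW, fun F' hF' hd => ?_⟩
    rcases hF' with rfl | hF'
    · exact Finset.disjoint_left.1 hd (Finset.mem_insert_self _ _) hvF
    · exact hG.2 F' hF' (hd.mono_left (Finset.subset_insert _ _))
  have hcone : ∀ {k : ℤ} {c : Finset V → K}, c ∈ familyChains K T' k →
      cone K v c ∈ familyChains K T (k + 1) := by
    intro k c hc G hG
    obtain ⟨h1, h2, h3⟩ := cone_degree hc hG
    refine ⟨?_, h3⟩
    have := hins h2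
    rwa [Finset.insert_erase h1] at this
  have hzero : ∀ {k : ℤ} {c : Finset V → K}, c ∈ familyChains K T' k → ∀ G ∉ T', c G = 0 :=
    fun hc G hG => not_not.1 fun h => hG (hc G h).1
  -- for a chain `c` on `T'` and `G ∈ T`, faces `G \ v` outside `T'` carry no boundary
  have hbzero : ∀ {k : ℤ} {c : Finset V → K}, c ∈ familyChains K T' k → ∀ G ∈ T,
      G.erase v ∉ T' → boundary K V c (G.erase v) = 0 := by
    intro k c hc G hG hE
    by_contra h
    obtain ⟨u, -, hne⟩ := exists_of_boundary_ne_zero h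
    have hsub := (Finset.subset_insert _ _).trans (hc _ hne).1.1
    refine hE ⟨hsub, fun F' hF' hd => hG.2 F' (Set.mem_insert_of_mem _ hF') ?_⟩
    rw [Finset.disjoint_left] at hd ⊢
    intro w hw hwF
    refine hd (Finset.mem_erase.2 ⟨?_, hw⟩) hwF
    rintro rfl
    exact hv F' hF' hwF
  have hbcone : ∀ {k : ℤ} {c : Finset V → K}, c ∈ familyChains K T' k → ∀ G ∈ T,
      boundary K V (cone K v c) G = - cone K v (boundary K V c) G := by
    intro k c hc G hG
    rw [boundary_cone_eq, hzero hc G (hTT' hG), zero_sub]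
  have hpos : ∀ G : Finset V, (-1 : K) ^ position G v ≠ 0 := fun G =>
    pow_ne_zero _ (neg_ne_zero.2 one_ne_zero)
  -- a chain on `T` as produced by `exists_homologous_supported` is a cone over a chain on `T'`
  have hlink : ∀ {k : ℤ} {z : Finset V → K}, z ∈ familyChains K T (k + 1) →
      (∀ G, z G ≠ 0 → v ∈ G ∧ G.erase v ∈ T') →
      ∃ c ∈ familyChains K T' k, cone K v c = z := by
    intro k z hz hsupp
    obtain ⟨c, hc, hc'⟩ := exists_cone_eq fun G hG => (hsupp G hG).1
    refine ⟨c, fun G hG => ?_, hc⟩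
    obtain ⟨h1, h2⟩ := hc' G hG
    have h3 := (hsupp _ h2).2
    rw [Finset.erase_insert h1] at h3
    have h4 := (hz _ h2).2
    rw [Finset.card_insert_of_notMem h1] at h4
    push_cast at h4
    exact ⟨h3, by linarith⟩
  suffices h : Nonempty (FamilyHomology K T' i ≃ₗ[K] FamilyHomology K T (i + 1)) from
    h.map LinearEquiv.symm
  refine nonempty_subquotient_equiv (cone K v) ?_ ?_ ?_
  · rintro c ⟨hc, hc0⟩
    refine ⟨hcone hc, fun G hG => ?_⟩
    rw [hbcone hc G hG, neg_eq_zero]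
    by_contra h
    obtain ⟨-, h1⟩ := cone_ne_zero h
    by_cases hE : G.erase v ∈ T'
    · exact h1 (hc0 _ hE)
    · exact h1 (hbzero hc G hG hE)
  · rintro c ⟨hc, hc0⟩
    constructor
    -- On `T` the boundary of `e` is a cone, so it vanishes on faces without `v`. This is enough to
    -- replace `e` by a cone over a chain on `T'`, from which `v` can be cancelled.
    · rintro ⟨-, e, he, hec⟩
      obtain ⟨-, -, e', he', -, hbd, hsupp⟩ := exists_homologous_supported hvF hvW hv he
        (fun G hG hvG => by rw [hec G hG, cone_of_notMem hvG])
      obtain ⟨c', hc', rfl⟩ := hlink he' hsupp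
      refine ⟨hc, -c', neg_mem hc', fun G hG => ?_⟩
      have h1 := hbd _ (hins hG)
      rw [hec _ (hins hG), hbcone hc' _ (hins hG), cone_insert (hvT' hG), cone_insert (hvT' hG),
        ← mul_neg] at h1
      rw [map_neg, Pi.neg_apply]
      exact mul_left_cancel₀ (hpos G) h1
    · rintro ⟨-, e, he, hec⟩
      refine ⟨hcone hc, -cone K v e, neg_mem (hcone he), fun G hG => ?_⟩
      rw [map_neg, Pi.neg_apply, hbcone he G hG, neg_neg]
      by_cases hvG : v ∈ G
      · rw [cone_of_mem hvG, cone_of_mem hvG]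
        by_cases hE : G.erase v ∈ T'
        · rw [hec _ hE]
        · rw [hbzero he G hG hE, hzero hc _ hE]
      · rw [cone_of_notMem hvG, cone_of_notMem hvG]
  · rintro z ⟨hz, hz0⟩
    obtain ⟨e, he, z', hz', hz'e, hbd, hsupp⟩ := exists_homologous_supported hvF hvW hv hz
      (fun G hG _ => hz0 G hG)
    obtain ⟨c, hc, rfl⟩ := hlink hz' hsupp
    refine ⟨c, ⟨hc, fun G hG => ?_⟩, sub_mem hz' hz, -e, neg_mem he, fun G hG => ?_⟩
    · have h1 := hbd _ (hins hG)
      rw [hz0 _ (hins hG), hbcone hc _ (hins hG), cone_insert (hvT' hG), neg_eq_zero] at h1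
      exact (mul_eq_zero.1 h1).resolve_left (hpos G)
    · rw [map_neg, Pi.neg_apply, Pi.sub_apply, hz'e G hG]
      ring

end FamilyLemmas

end PathRuns

namespace PathRuns

/-! # Facets of runs -/

theorem facets_generated {V : Type*} {𝓕 : Set (Finset V)} {m : ℕ} (h : ∀ F ∈ 𝓕, F.card = m) :
    facets (generated 𝓕) = 𝓕 := by
  ext F
  constructor
  · rintro ⟨hF, hmax⟩
    obtain ⟨G, hG, hFG⟩ := mem_lowerClosure.1 hF
    have := hmax (subset_lowerClosure hG) hFG
    rwa [le_antisymm hFG this]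
  · intro hF
    refine ⟨subset_lowerClosure hF, fun G hG hFG => ?_⟩
    obtain ⟨H, hH, hGH⟩ := mem_lowerClosure.1 hG
    have : F = H := Finset.eq_of_subset_of_card_le (hFG.trans hGH) (by rw [h F hF, h H hH])
    rwa [this]

theorem mem_vertexSet {V : Type*} [Fintype V] {Δ : LowerSet (Finset V)} {v : V} :
    v ∈ vertexSet Δ ↔ {v} ∈ Δ := by
  simp only [vertexSet, Finset.mem_filter, Finset.mem_univ, true_and]

theorem mem_vertexSet_generated {V : Type*} [Fintype V] {𝓕 : Set (Finset V)} {v : V} :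
    v ∈ vertexSet (generated 𝓕) ↔ ∃ F ∈ 𝓕, v ∈ F := by
  rw [mem_vertexSet, generated, mem_lowerClosure]
  simp

section Run

variable {V : Type*} [DecidableEq V] {l m q : ℕ} {x : ℕ → V}

theorem facet_le {a : ℕ} (ha : a < q) : a * l + m ≤ (q - 1) * l + m :=
  Nat.add_le_add_right (Nat.mul_le_mul_right l (Nat.le_sub_one_of_lt ha)) m

theorem mem_runFacet {v : V} {a : ℕ} :
    v ∈ runFacet l m x a ↔ ∃ k, a * l ≤ k ∧ k < a * l + m ∧ x k = v := by
  simp [runFacet, and_assoc]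

theorem label_mem_runFacet (hx : Set.InjOn x (Set.Iio ((q - 1) * l + m))) {a k : ℕ} (ha : a < q)
    (hk : k < (q - 1) * l + m) : x k ∈ runFacet l m x a ↔ a * l ≤ k ∧ k < a * l + m := by
  rw [mem_runFacet]
  constructor
  · rintro ⟨k', h1, h2, h3⟩
    rw [← hx (h2.trans_le (facet_le ha)) hk h3]
    exact ⟨h1, h2⟩
  · rintro ⟨h1, h2⟩
    exact ⟨k, h1, h2, rfl⟩

theorem card_runFacet (hx : Set.InjOn x (Set.Iio ((q - 1) * l + m))) {a : ℕ} (ha : a < q) :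
    (runFacet l m x a).card = m := by
  have hinj : Set.InjOn x (Finset.Ico (a * l) (a * l + m)) := by
    refine hx.mono fun k hk => ?_
    rw [Finset.coe_Ico] at hk
    exact hk.2.trans_le (facet_le ha)
  rw [runFacet, Finset.card_image_of_injOn hinj, Nat.card_Ico, Nat.add_sub_cancel_left]

/-- As `l ≤ m`, consecutive facets leave no gap, so front facets fill an initial interval of labels.
-/
theorem frontVertices_succ (hlm : l ≤ m) (b : ℕ) :
    frontVertices l m x (b + 1) = (Finset.range (b * l + m)).image x := by
  induction b with
  | zero => 
    rw [frontVertices, zero_add, Finset.range_one, Finset.singleton_biUnion, runFacet, zero_mul,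
      zero_add, Finset.range_eq_Ico]
  | succ b ih =>
    have h : frontVertices l m x (b + 1 + 1) =
        runFacet l m x (b + 1) ∪ frontVertices l m x (b + 1) := by
      simp [frontVertices, Finset.range_add_one]
    rw [h, ih, runFacet, ← Finset.image_union]
    congr 1
    ext k
    have : (b + 1) * l = b * l + l := by ring
    simp only [Finset.mem_union, Finset.mem_Ico, Finset.mem_range, this]
    omega

theorem IsRun.facets_eq {R : LowerSet (Finset V)} (h : IsRun l m q x R) :
    facets R = {F | ∃ a < q, F = runFacet l m x a} := by
  rw [h.eq]
  refine facets_generated (m := m) ?_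
  rintro _ ⟨a, ha, rfl⟩
  exact card_runFacet h.injOn ha

theorem IsRun.label_mem [Fintype V] {R : LowerSet (Finset V)} (h : IsRun l m q x R)
    (hlm : l ≤ m) {k : ℕ} (hk : k < (q - 1) * l + m) : x k ∈ vertexSet R := by
  have h1 : x k ∈ frontVertices l m x (q - 1 + 1) := by
    rw [frontVertices_succ hlm]
    exact Finset.mem_image_of_mem _ (Finset.mem_range.2 hk)
  rw [Nat.sub_add_cancel h.pos, frontVertices, Finset.mem_biUnion] at h1
  obtain ⟨a, ha, h1⟩ := h1
  rw [h.eq, mem_vertexSet_generated]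
  exact ⟨_, ⟨a, Finset.mem_range.1 ha, rfl⟩, h1⟩

theorem IsRun.subset_vertexSet [Fintype V] {R : LowerSet (Finset V)} (h : IsRun l m q x R)
    {F : Finset V} (hF : F ∈ facets R) : F ⊆ vertexSet R := by
  intro v hv
  rw [h.facets_eq] at hF
  rw [h.eq, mem_vertexSet_generated]
  exact ⟨F, hF, hv⟩

end Run

/-! # Reduction of a run

A run with labels `x 0, x 1, …` in a vertex set `U`, in the presence of a collection `𝓞` of faces
disjoint from the run. -/

section Reduction

variable {V : Type*} [Fintype V] [LinearOrder V] {l m q s t : ℕ} {x : ℕ → V}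
  {𝓞 : Set (Finset V)} {U : Finset V}

/-- The facets `c, …, q - 1` of a run. -/
def backFacets (l m : ℕ) (x : ℕ → V) (c q : ℕ) : Set (Finset V) :=
  {F | ∃ a, c ≤ a ∧ a < q ∧ F = runFacet l m x a}

theorem label_notMem_backFacets (hx : Set.InjOn x (Set.Iio ((q - 1) * l + m)))
    (h𝓞 : ∀ F ∈ 𝓞, ∀ k < (q - 1) * l + m, x k ∉ F) {c k : ℕ} (hk : k < (q - 1) * l + m)
    (hc : k < c * l) {F : Finset V} (hF : F ∈ 𝓞 ∪ backFacets l m x c q) : x k ∉ F := by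
  rcases hF with hF | ⟨a, hca, haq, rfl⟩
  · exact h𝓞 F hF k hk
  · rw [label_mem_runFacet hx haq hk]
    rintro ⟨h, -⟩
    exact absurd (hc.trans_le (Nat.mul_le_mul_right l hca)) h.not_gt

/-- Removal of the first facet `c` of a shortened run, if the label `k` occurs only there. -/
theorem nonempty_remove_facet_equiv (K : Type*) [Field K]
    (hx : Set.InjOn x (Set.Iio ((q - 1) * l + m))) (hU : ∀ k < (q - 1) * l + m, x k ∈ U)
    (h𝓞 : ∀ F ∈ 𝓞, ∀ k < (q - 1) * l + m, x k ∉ F) {c c' e k : ℕ} (hcq : c < q)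
    (hce : c * l ≤ e) (hek : e ≤ k) (hkc : k < c * l + m) (hkc' : k < c' * l) (i : ℤ) :
    Nonempty (FamilyHomology K (transversals (U \ (Finset.range e).image x)
        (insert (runFacet l m x c) (𝓞 ∪ backFacets l m x c' q))) (i + 1) ≃ₗ[K]
      FamilyHomology K (transversals (U \ (Finset.range (c * l + m)).image x)
        (𝓞 ∪ backFacets l m x c' q)) i) := by
  have hkN : k < (q - 1) * l + m := hkc.trans_le (facet_le hcq)
  have hW : U \ (Finset.range (c * l + m)).image x =
      (U \ (Finset.range e).image x) \ runFacet l m x c := by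
    rw [sdiff_sdiff, runFacet, Finset.sup_eq_union, ← Finset.image_union]
    congr 2
    ext u
    simp only [Finset.mem_union, Finset.mem_Ico, Finset.mem_range]
    omega
  rw [hW]
  refine nonempty_transversals_insert_equiv (v := x k) ?_ ?_ ?_ i
  · exact (label_mem_runFacet hx hcq hkN).2 ⟨hce.trans hek, hkc⟩
  · rw [Finset.mem_sdiff, Finset.mem_image]
    refine ⟨hU k hkN, ?_⟩
    rintro ⟨k', hk', h⟩
    rw [Finset.mem_range] at hk'
    have := hx (hk'.trans_le (hek.trans hkN.le)) hkN h
    omega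
  · exact fun F hF => label_notMem_backFacets hx h𝓞 hkN hkc' hF

/-- Removal of the `t + 1` front facets of a run of length at least two. -/
theorem nonempty_remove_front_equiv (K : Type*) [Field K] (hs : s < l) (hmt : m = t * l + s)
    (ht : 2 ≤ t)
    (hx : Set.InjOn x (Set.Iio ((q - 1) * l + m))) (hU : ∀ k < (q - 1) * l + m, x k ∈ U)
    (h𝓞 : ∀ F ∈ 𝓞, ∀ k < (q - 1) * l + m, x k ∉ F) {c e : ℕ} (hcq : c + 2 ≤ q)
    (hce : c * l ≤ e) (he : e ≤ c * l + s) (i : ℤ) :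
    Nonempty (FamilyHomology K (transversals (U \ (Finset.range e).image x)
        (𝓞 ∪ backFacets l m x c q)) (i + 2) ≃ₗ[K]
      FamilyHomology K (transversals (U \ (Finset.range ((c + t + 1) * l + s)).image x)
        (𝓞 ∪ backFacets l m x (c + t + 1) q)) i) := by
  have e1 : (c + 1) * l = c * l + l := by ring
  have e2 : (c + t + 1) * l = c * l + t * l + l := by ring
  have hlt : 2 * l ≤ t * l := Nat.mul_le_mul_right l ht
  have h1 : 𝓞 ∪ backFacets l m x c q =
      insert (runFacet l m x c) (𝓞 ∪ backFacets l m x (c + 1) q) := by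
    ext F
    simp only [Set.mem_union, Set.mem_insert_iff]
    constructor
    · rintro (h | ⟨a, h1, h2, rfl⟩)
      · exact Or.inr (Or.inl h)
      · rcases h1.eq_or_lt with rfl | h1
        · exact Or.inl rfl
        · exact Or.inr (Or.inr ⟨a, h1, h2, rfl⟩)
    · rintro (rfl | h | ⟨a, h1, h2, rfl⟩)
      · exact Or.inr ⟨c, le_rfl, by omega, rfl⟩
      · exact Or.inl h
      · exact Or.inr ⟨a, by omega, h2, rfl⟩
  -- Beyond the deleted labels, facet `c + 1` keeps only those from `c * l + m` up to `(c + 1) * l +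
  -- m`. For `c + 1 ≤ a ≤ c + t` these all lie in facet `a`, because `t * l ≤ m`; so meeting facet
  -- `c + 1` suffices.
  have h2 : transversals (U \ (Finset.range (c * l + m)).image x)
        (𝓞 ∪ backFacets l m x (c + 1) q) =
      transversals (U \ (Finset.range (c * l + m)).image x)
        (insert (runFacet l m x (c + 1)) (𝓞 ∪ backFacets l m x (c + t + 1) q)) := by
    ext G
    refine and_congr_right fun hG => ⟨?_, ?_⟩
    · rintro h F (rfl | hF | ⟨a, h1, h2, rfl⟩)
      · exact h _ (Or.inr ⟨c + 1, le_rfl, by omega, rfl⟩)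
      · exact h F (Or.inl hF)
      · exact h _ (Or.inr ⟨a, by omega, h2, rfl⟩)
    · rintro h F (hF | ⟨a, h1, h2, rfl⟩)
      · exact h F (Or.inr (Or.inl hF))
      · by_cases hat : c + t + 1 ≤ a
        · exact h _ (Or.inr (Or.inr ⟨a, hat, h2, rfl⟩))
        · have h3 := h _ (Or.inl rfl)
          rw [Finset.not_disjoint_iff] at h3 ⊢
          obtain ⟨v, hvG, hvF⟩ := h3
          obtain ⟨k, -, hk, rfl⟩ := mem_runFacet.1 hvF
          have hk' : ¬ k < c * l + m := fun hlt =>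
            (Finset.mem_sdiff.1 (hG hvG)).2 (Finset.mem_image_of_mem _ (Finset.mem_range.2 hlt))
          have h4 : (c + 1) * l ≤ a * l := Nat.mul_le_mul_right l h1
          have h5 : a * l ≤ (c + t) * l := Nat.mul_le_mul_right l (by omega)
          have e3 : (c + t) * l = c * l + t * l := by ring
          exact ⟨x k, hvG, mem_runFacet.2 ⟨k, by omega, by omega, rfl⟩⟩
  have h3 : (c + t + 1) * l + s = (c + 1) * l + m := by omega
  -- The label `c * l + s` is undeleted since `e ≤ c * l + s`, and precedes facet `c + 1` since `s <
  -- l`.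
  obtain ⟨φ⟩ := nonempty_remove_facet_equiv K hx hU h𝓞 (c := c) (c' := c + 1) (e := e)
    (k := c * l + s) (by omega) hce he (by omega) (by omega) (i + 1)
  -- The label `c * l + m` is the first surviving one; it precedes facet `c + t + 1`, again by `s <
  -- l`.
  obtain ⟨ψ⟩ := nonempty_remove_facet_equiv K hx hU h𝓞 (c := c + 1) (c' := c + t + 1)
    (e := c * l + m) (k := c * l + m) (by omega) (by omega) le_rfl (by omega) (by omega) i
  rw [← h1, h2, add_assoc] at φ
  rw [← h3] at ψ
  exact ⟨φ.trans ψ⟩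

/-- Removal of `p (t + 1)` front facets. -/
theorem nonempty_remove_fronts_equiv (K : Type*) [Field K] (hs : s < l) (hmt : m = t * l + s)
    (ht : 2 ≤ t)
    (hx : Set.InjOn x (Set.Iio ((q - 1) * l + m))) (hU : ∀ k < (q - 1) * l + m, x k ∈ U)
    (h𝓞 : ∀ F ∈ 𝓞, ∀ k < (q - 1) * l + m, x k ∉ F) (p : ℕ) (hp : (p + 1) * (t + 1) ≤ q + (t - 1))
    (i : ℤ) :
    Nonempty (FamilyHomology K (transversals U (𝓞 ∪ backFacets l m x 0 q)) i ≃ₗ[K]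
      FamilyHomology K
        (transversals (U \ (Finset.range ((p + 1) * (t + 1) * l + s)).image x)
          (𝓞 ∪ backFacets l m x ((p + 1) * (t + 1)) q)) (i - 2 * ((p + 1 : ℕ) : ℤ))) := by
  -- The bound `hp` amounts to `p * (t + 1) + 2 ≤ q`: only the first two facets of a group are
  -- needed, so the last group may be incomplete.
  induction p with
  | zero =>
    obtain ⟨φ⟩ := nonempty_remove_front_equiv K hs hmt ht hx hU h𝓞 (c := 0) (e := 0) (by omega)
      (by simp) (by simp) (i - 2)
    have e1 : (0 + 1) * (t + 1) = 0 + t + 1 := by ring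
    have e2 : i - 2 * ((0 + 1 : ℕ) : ℤ) = i - 2 := by push_cast; ring
    rw [e1, e2]
    rw [sub_add_cancel, Finset.range_zero, Finset.image_empty, Finset.sdiff_empty] at φ
    exact ⟨φ⟩
  | succ p ih =>
    have e1 : (p + 1 + 1) * (t + 1) = (p + 1) * (t + 1) + t + 1 := by ring
    have e2 : i - 2 * ((p + 1 : ℕ) : ℤ) = i - 2 * ((p + 1 + 1 : ℕ) : ℤ) + 2 := by push_cast; ring
    obtain ⟨φ⟩ := ih (by omega)
    -- Earlier deletions have also taken the first `s` labels of the next facet, the most that is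
    -- allowed.
    obtain ⟨ψ⟩ := nonempty_remove_front_equiv K hs hmt ht hx hU h𝓞 (c := (p + 1) * (t + 1))
      (e := (p + 1) * (t + 1) * l + s) (by omega) (by omega) le_rfl
      (i - 2 * ((p + 1 + 1 : ℕ) : ℤ))
    rw [e2] at φ
    rw [e1]
    exact ⟨φ.trans ψ⟩

/-- If the last group of facets of a run has at least three and at most `t + 1` members, then the
transversals are acyclic. -/
theorem subsingleton_of_last_group (K : Type*) [Field K] (hs : s < l) (hmt : m = t * l + s)
    (ht : 2 ≤ t)
    (hx : Set.InjOn x (Set.Iio ((q - 1) * l + m))) (hU : ∀ k < (q - 1) * l + m, x k ∈ U)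
    (h𝓞 : ∀ F ∈ 𝓞, ∀ k < (q - 1) * l + m, x k ∉ F) (p : ℕ) (hp : p * (t + 1) + 3 ≤ q)
    (hq : q ≤ (p + 1) * (t + 1)) (i : ℤ) :
    Subsingleton (FamilyHomology K (transversals U (𝓞 ∪ backFacets l m x 0 q)) i) := by
  have e1 : (p + 1) * (t + 1) = p * (t + 1) + t + 1 := by ring
  obtain ⟨φ⟩ := nonempty_remove_fronts_equiv K hs hmt ht hx hU h𝓞 p (by omega) i
  -- The third facet of the last group reaches `l` labels beyond the second, where the deletion
  -- stops.
  have hN : (p + 1) * (t + 1) * l + s < (q - 1) * l + m := by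
    have h1 : (p * (t + 1) + 2) * l ≤ (q - 1) * l := Nat.mul_le_mul_right l (by omega)
    have h2 : (p * (t + 1) + 2) * l = p * (t + 1) * l + 2 * l := by ring
    have h3 : (p + 1) * (t + 1) * l = p * (t + 1) * l + t * l + l := by ring
    omega
  have hsub := subsingleton_familyHomology (K := K)
    (W := U \ (Finset.range ((p + 1) * (t + 1) * l + s)).image x)
    (𝓕 := 𝓞 ∪ backFacets l m x ((p + 1) * (t + 1)) q) (u := x ((p + 1) * (t + 1) * l + s)) ?_ ?_
    (i - 2 * ((p + 1 : ℕ) : ℤ))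
  · exact φ.injective.subsingleton
  · rw [Finset.mem_sdiff, Finset.mem_image]
    refine ⟨hU _ hN, ?_⟩
    rintro ⟨k, hk, h⟩
    rw [Finset.mem_range] at hk
    exact hk.ne (hx (hk.trans hN) hN h)
  · rintro F (hF | ⟨a, h1, h2, rfl⟩)
    · exact h𝓞 F hF _ hN
    · omega

end Reduction

/-! # Disjoint unions of runs -/

section Union

variable {V : Type*} [Fintype V] [DecidableEq V] {l m r : ℕ} {Γ : LowerSet (Finset V)}
  {R : Fin r → LowerSet (Finset V)} {len : Fin r → ℕ} {x : Fin r → ℕ → V}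

theorem IsDisjointUnionOfRuns.eq_generated (h : IsDisjointUnionOfRuns l m Γ R len x) :
    Γ = generated (⋃ j, facets (R j)) := by
  rw [h.union, generated, lowerClosure_iUnion]
  refine iSup_congr fun j => ?_
  rw [(h.isRun j).facets_eq]
  exact (h.isRun j).eq

theorem IsDisjointUnionOfRuns.facets_eq (h : IsDisjointUnionOfRuns l m Γ R len x) :
    facets Γ = ⋃ j, facets (R j) := by
  rw [h.eq_generated]
  refine facets_generated (m := m) fun F hF => ?_
  obtain ⟨j, hj⟩ := Set.mem_iUnion.1 hF
  rw [(h.isRun j).facets_eq] at hj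
  obtain ⟨a, ha, rfl⟩ := hj
  exact card_runFacet (h.isRun j).injOn ha

theorem IsDisjointUnionOfRuns.facets_eq_union (h : IsDisjointUnionOfRuns l m Γ R len x)
    (j : Fin r) :
    facets Γ = otherFacets R j ∪ {F | ∃ a < len j, F = runFacet l m (x j) a} := by
  rw [h.facets_eq, ← (h.isRun j).facets_eq]
  ext F
  simp only [Set.mem_iUnion, Set.mem_union, otherFacets, Set.mem_ofPred_eq]
  constructor
  · rintro ⟨j', hj'⟩
    by_cases hjj : j' = j
    · exact Or.inr (hjj ▸ hj')
    · exact Or.inl ⟨j', hjj, hj'⟩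
  · rintro (⟨j', -, hj'⟩ | hj)
    · exact ⟨j', hj'⟩
    · exact ⟨j, hj⟩

theorem IsDisjointUnionOfRuns.vertexSet_subset (h : IsDisjointUnionOfRuns l m Γ R len x)
    (j : Fin r) : vertexSet (R j) ⊆ vertexSet Γ := by
  intro v hv
  rw [mem_vertexSet] at hv ⊢
  rw [h.union, LowerSet.mem_iSup_iff]
  exact ⟨j, hv⟩

theorem IsDisjointUnionOfRuns.label_notMem (h : IsDisjointUnionOfRuns l m Γ R len x)
    (hlm : l ≤ m) (j : Fin r) {F : Finset V} (hF : F ∈ otherFacets R j) {k : ℕ}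
    (hk : k < (len j - 1) * l + m) : x j k ∉ F := by
  obtain ⟨j', hj', hF⟩ := hF
  intro hkF
  exact Finset.disjoint_left.1 (h.disjoint j' j hj') ((h.isRun j').subset_vertexSet hF hkF)
    ((h.isRun j).label_mem hlm hk)

/-- Distinct runs share no vertex. This matches the vertex set left by deleting a whole run with the
one in the statement. -/
theorem IsDisjointUnionOfRuns.vertexSet_otherFacets (h : IsDisjointUnionOfRuns l m Γ R len x)
    (hlm : l ≤ m) (j : Fin r) : vertexSet (generated (otherFacets R j)) =
      vertexSet Γ \ (Finset.range ((len j - 1) * l + m)).image (x j) := by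
  ext v
  rw [mem_vertexSet_generated, Finset.mem_sdiff, h.eq_generated, mem_vertexSet_generated,
    ← h.facets_eq, h.facets_eq_union j]
  constructor
  · rintro ⟨F, hF, hv⟩
    refine ⟨⟨F, Or.inl hF, hv⟩, fun hv' => ?_⟩
    obtain ⟨k, hk, rfl⟩ := Finset.mem_image.1 hv'
    exact h.label_notMem hlm j hF (Finset.mem_range.1 hk) hv
  · rintro ⟨⟨F, hF | ⟨a, ha, rfl⟩, hv⟩, hv'⟩
    · exact ⟨F, hF, hv⟩
    · obtain ⟨k, -, hk, rfl⟩ := mem_runFacet.1 hv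
      exact absurd (Finset.mem_image_of_mem _ (Finset.mem_range.2 (hk.trans_le (facet_le ha)))) hv'

end Union

end PathRuns

/-! ### The proposition -/

open PathRuns

theorem proposition4p3 (K : Type*) [Field K] (l m n s t : ℕ)
    (hl : 0 < l) (hm : 2 ≤ m) (hmn : m ≤ n) (hln : l ∣ n) (hlm : l ≤ m - 1) (hl2 : 2 * l ≤ n)
    (hs : s < l) (hmt : m = t * l + s) (ht : 2 ≤ t)
    (Γ : LowerSet (Finset (Fin n)))
    (hΓ : PathRuns.IsSubcollection Γ (PathRuns.cyclePathComplex n l m))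
    (r : ℕ) (R : Fin r → LowerSet (Finset (Fin n))) (len p d : Fin r → ℕ)
    (x : Fin r → ℕ → Fin n)
    (hruns : PathRuns.IsDisjointUnionOfRuns l m Γ R len x)
    (hlen : ∀ j, len j = p j * (t + 1) + d j) (hd : ∀ j, d j ≤ t)
    (j : Fin r) (i : ℤ) :
    -- (1) a run of length at least t + 2 can be shortened to its last `d j` facets
    (t + 2 ≤ len j →
      Nonempty (PathRuns.ReducedHomology K (PathRuns.facetComplement Γ) i ≃ₗ[K]
        PathRuns.ReducedHomology K
          (PathRuns.complementComplex
            (PathRuns.vertexSet Γ \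
              PathRuns.frontVertices l m (x j) ((p j - 1) * (t + 1) + 2))
            (PathRuns.otherFacets R j ∪
              {F | ∃ a, p j * (t + 1) ≤ a ∧ a < p j * (t + 1) + d j ∧
                F = PathRuns.runFacet l m (x j) a}))
          (i - 2 * (p j : ℤ)))) ∧
    -- (2) a run of length 2 can be removed
    (len j = 2 → 2 ≤ r →
      Nonempty (PathRuns.ReducedHomology K (PathRuns.facetComplement Γ) i ≃ₗ[K]
        PathRuns.ReducedHomology K
          (PathRuns.complementComplex
            (PathRuns.vertexSet (PathRuns.generated (PathRuns.otherFacets R j)))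
            (PathRuns.otherFacets R j))
          (i - 2))) ∧
    -- (3) a run of length 1 can be removed
    (len j = 1 → 2 ≤ r →
      Nonempty (PathRuns.ReducedHomology K (PathRuns.facetComplement Γ) i ≃ₗ[K]
        PathRuns.ReducedHomology K
          (PathRuns.complementComplex
            (PathRuns.vertexSet (PathRuns.generated (PathRuns.otherFacets R j)))
            (PathRuns.otherFacets R j))
          (i - 1))) ∧
    -- (4) vanishing
    (d j ≠ 1 ∧ d j ≠ 2 →
      Subsingleton (PathRuns.ReducedHomology K (PathRuns.facetComplement Γ) i)) := by
  have hlm' : l ≤ m := by omega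
  set q := len j with hq
  have hrun := hruns.isRun j
  have hx := hrun.injOn
  have hU : ∀ k < (q - 1) * l + m, x j k ∈ vertexSet Γ := fun k hk =>
    hruns.vertexSet_subset j (hrun.label_mem hlm' hk)
  have h𝓞 : ∀ F ∈ otherFacets R j, ∀ k < (q - 1) * l + m, x j k ∉ F := fun F hF k hk =>
    hruns.label_notMem hlm' j hF hk
  have hfac : facets Γ = otherFacets R j ∪ backFacets l m (x j) 0 q := by
    rw [hruns.facets_eq_union j]
    simp [backFacets, hq]
  have hΓne : (vertexSet Γ).Nonempty := ⟨_, hU 0 (by omega)⟩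
  have hE : facetComplement Γ = complementComplex (vertexSet Γ)
      (otherFacets R j ∪ backFacets l m (x j) 0 q) := by
    rw [← hfac]; rfl
  obtain ⟨α⟩ := nonempty_transversals_equiv (K := K) hΓne
    (otherFacets R j ∪ backFacets l m (x j) 0 q) i
  rw [← hE] at α
  -- A second run keeps the remaining vertex set nonempty, as the connecting isomorphism requires.
  have hother : 2 ≤ r → (vertexSet (generated (otherFacets R j))).Nonempty := by
    intro hr
    obtain ⟨j', hj'⟩ : ∃ j' : Fin r, j' ≠ j := by
      have : Nontrivial (Fin r) := Fin.nontrivial_iff_two_le.2 hr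
      exact exists_ne j
    have hrun' := hruns.isRun j'
    refine ⟨x j' 0, mem_vertexSet_generated.2 ⟨runFacet l m (x j') 0, ⟨j', hj', ?_⟩, ?_⟩⟩
    · rw [hrun'.facets_eq]
      exact ⟨0, hrun'.pos, rfl⟩
    · exact mem_runFacet.2 ⟨0, by omega, by omega, rfl⟩
  have hqj : q = p j * (t + 1) + d j := hlen j
  refine ⟨fun h => ?_, fun h hr => ?_, fun h hr => ?_, fun h => ?_⟩
  · obtain ⟨p', hp'⟩ : ∃ p', p j = p' + 1 := by
      refine Nat.exists_eq_succ_of_ne_zero fun h0 => ?_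
      rw [h0] at hqj
      have := hd j
      omega
    rw [hp'] at hqj ⊢
    obtain ⟨φ⟩ := nonempty_remove_fronts_equiv K hs hmt ht hx hU h𝓞 p' (by omega) (i + 1)
    have hfront : frontVertices l m (x j) ((p' + 1 - 1) * (t + 1) + 2) =
        (Finset.range ((p' + 1) * (t + 1) * l + s)).image (x j) := by
      rw [frontVertices_succ hlm', hmt, Nat.add_sub_cancel]
      congr 2
      ring
    -- Even when `d j = 0` some label of the run survives, because `m ≥ 2 * l + s`; hence `W` is
    -- nonempty.
    have hN : (p' + 1) * (t + 1) * l + s < (q - 1) * l + m := by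
      have h1 : ((p' + 1) * (t + 1)) * l ≤ (q - 1 + 1) * l := Nat.mul_le_mul_right l (by omega)
      have h2 : (q - 1 + 1) * l = (q - 1) * l + l := by ring
      have h3 : 2 * l ≤ t * l := Nat.mul_le_mul_right l ht
      omega
    have hW : (vertexSet Γ \ frontVertices l m (x j) ((p' + 1 - 1) * (t + 1) + 2)).Nonempty := by
      refine ⟨x j ((p' + 1) * (t + 1) * l + s), ?_⟩
      rw [hfront, Finset.mem_sdiff, Finset.mem_image]
      refine ⟨hU _ hN, ?_⟩
      rintro ⟨k, hk, hkx⟩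
      rw [Finset.mem_range] at hk
      exact hk.ne (hx (hk.trans hN) hN hkx)
    obtain ⟨β⟩ := nonempty_transversals_equiv (K := K) hW
      (otherFacets R j ∪ backFacets l m (x j) ((p' + 1) * (t + 1)) q)
      (i - 2 * ((p' + 1 : ℕ) : ℤ))
    rw [← hfront, add_sub_right_comm] at φ
    rw [← hqj]
    exact ⟨(α.trans φ).trans β.symm⟩
  · obtain ⟨φ⟩ := nonempty_remove_front_equiv K hs hmt ht hx hU h𝓞 (c := 0) (e := 0)
      (by omega) (by simp) (by simp) (i - 2 + 1)
    obtain ⟨β⟩ := nonempty_transversals_equiv (K := K) (hother hr) (otherFacets R j) (i - 2)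
    have hback : backFacets l m (x j) (0 + t + 1) q = ∅ := by
      refine Set.eq_empty_iff_forall_notMem.2 ?_
      rintro _ ⟨a, h1, h2, -⟩
      omega
    have hW : vertexSet (generated (otherFacets R j)) =
        vertexSet Γ \ (Finset.range ((0 + t + 1) * l + s)).image (x j) := by
      rw [hruns.vertexSet_otherFacets hlm' j, ← hq, h, hmt]
      congr 3
      ring
    have hi : i - 2 + 1 + 2 = i + 1 := by ring
    rw [hback, Set.union_empty, ← hW, Finset.range_zero, Finset.image_empty, Finset.sdiff_empty,
      hi] at φ
    exact ⟨(α.trans φ).trans β.symm⟩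
  · obtain ⟨φ⟩ := nonempty_remove_facet_equiv K hx hU h𝓞 (c := 0) (c' := 1) (e := 0) (k := 0)
      (by omega) (by simp) le_rfl (by omega) (by omega) (i - 1 + 1)
    obtain ⟨β⟩ := nonempty_transversals_equiv (K := K) (hother hr) (otherFacets R j) (i - 1)
    have hback : backFacets l m (x j) 1 q = ∅ := by
      refine Set.eq_empty_iff_forall_notMem.2 ?_
      rintro _ ⟨a, h1, h2, -⟩
      omega
    have hback' : otherFacets R j ∪ backFacets l m (x j) 0 q =
        insert (runFacet l m (x j) 0) (otherFacets R j) := by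
      rw [Set.insert_eq, Set.union_comm]
      congr 1
      ext F
      simp [backFacets, h]
    have hW : vertexSet (generated (otherFacets R j)) =
        vertexSet Γ \ (Finset.range (0 * l + m)).image (x j) := by
      rw [hruns.vertexSet_otherFacets hlm' j, ← hq, h]
    have hi : i - 1 + 1 + 1 = i + 1 := by ring
    rw [hback, Set.union_empty, ← hW, Finset.range_zero, Finset.image_empty, Finset.sdiff_empty,
      hi, ← hback'] at φ
    exact ⟨(α.trans φ).trans β.symm⟩
  · have hpos : 0 < q := hrun.pos
    have hdj := hd j
    -- For `d j = 0` the last group is a full one, with `t + 1 ≥ 3` facets; otherwise it consists of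
    -- the last `d j ≥ 3` facets.
    have hlast : ∃ p', p' * (t + 1) + 3 ≤ q ∧ q ≤ (p' + 1) * (t + 1) := by
      by_cases h0 : d j = 0
      · obtain ⟨p', hp'⟩ : ∃ p', p j = p' + 1 := by
          refine Nat.exists_eq_succ_of_ne_zero fun hp0 => ?_
          rw [hp0, h0] at hqj
          omega
        rw [hp', h0] at hqj
        have : (p' + 1) * (t + 1) = p' * (t + 1) + t + 1 := by ring
        exact ⟨p', by omega, by omega⟩
      · have : (p j + 1) * (t + 1) = p j * (t + 1) + t + 1 := by ring
        exact ⟨p j, by omega, by omega⟩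
    obtain ⟨p', h1, h2⟩ := hlast
    have := subsingleton_of_last_group K hs hmt ht hx hU h𝓞 p' h1 h2 (i + 1)
    exact α.injective.subsingleton
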